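/- Let $\mathrm{FI}$ be the category of the sets $[n]=\{1,\dots,n\}$, $n\ge 0$, and injections. An FI-module over a ring $k$ is a functor $V$ from $\mathrm{FI}$ to $k$-modules. It is *finitely generated in degree $\le d$* if there is a finite subset of $V_0\sqcup\dots\sqcup V_d$ whose images under the maps induced by injections span $V_n$ for every $n$; it is *finitely generated* if this holds for some $d$; it is *$d$-small* if it is finitely generated and is a subquotient of an FI-module that is finitely generated in degree $\le d$. An FI-simplicial-complex $X_\bullet$ is a functor from $\mathrm{FI}$ to finite simplicial complexes and simplicial maps. Let $V_i(X_n)$ be the set of $i$-simplices of $X_n$. Let $\mathbb{R}V_i(X_\bullet)$ and $\mathbb{R}\binom{V_i(X_\bullet)}{r}$ be the FI-modules over $\mathbb{R}$ whose values at $[n]$ are the vector spaces with bases $V_i(X_n)$ and the set of $r$-element subsets of $V_i(X_n)$, respectively; a basis element is sent to its image, or to $0$ if its image is not an $i$-simplex (respectively, not a set of $r$ distinct $i$-simplices). Let $H_i(X_\bullet)$ be the FI-module over $\mathbb{Z}$ with $[n]\mapsto H_i(X_n;\mathbb{Z})$ (simplicial homology). Say that $X_\bullet$ is *vertex-stable with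 stable degree $\le d$* if $\mathbb{R}V_0(X_\bullet)$ is finitely generated in degree $\le d$, and that $X_\bullet$ is *representation stable* if $H_i(X_\bullet)$ is a finitely generated FI-module over $\mathbb{Z}$ for every $i\ge 0$. **Theorem.** Let $X_\bullet$ be a vertex-stable FI-simplicial-complex with stable degree $\le d$. Then: 1. for all $i\ge 0$, the FI-module $\mathbb{R}V_i(X_\bullet)$ is $d(i+1)$-small; 2. for all $i,r\ge 0$, the FI-module $\mathbb{R}\binom{V_i(X_\bullet)}{r}$ is $rd(i+1)$-small; 3. for all $i\ge 0$, the FI-module $H_i(X_\bullet)$ over $\mathbb{Z}$ is $d(i+1)$-small. In particular, $X_\bullet$ is representation stable. -/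

import Mathlib

open CategoryTheory

universe u

noncomputable section

/-! ### The category FI and FI-modules -/

/-- The category `FI`: its objects are the finite sets `[n]`, `n ≥ 0`. -/
structure FI where
  size : ℕ

/-- The morphisms of `FI` from `[m]` to `[n]` are the injections `[m] ↪ [n]`. -/
instance : Category FI where
  Hom m n := Fin m.size ↪ Fin n.size
  id m := Function.Embedding.refl (Fin m.size)
  comp f g := Function.Embedding.trans f g

/-- An FI-module over `k` is a functor from `FI` to the category of `k`-modules. -/
abbrev FIModule (k : Type) [CommRing k] := FI ⥤ ModuleCat.{u} k

namespace FIModule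

variable {k : Type} [CommRing k]

/-- `V` is finitely generated in degree `≤ d`: there is a finite set of elements of
`V_0 ⊔ ⋯ ⊔ V_d` whose images under all the maps `V(f)` span every `V_n`. -/
def FinGenInDegreeLE (V : FIModule.{u} k) (d : ℕ) : Prop :=
  ∃ S : Set (Σ m : FI, V.obj m), S.Finite ∧ (∀ x ∈ S, x.1.size ≤ d) ∧
    ∀ n : FI, Submodule.span k
      {y : V.obj n | ∃ x ∈ S, ∃ f : x.1 ⟶ n, y = (V.map f).hom x.2} = ⊤

/-- `V` is finitely generated (a finite generating set lies in bounded degree). -/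
def IsFinGen (V : FIModule.{u} k) : Prop :=
  ∃ d : ℕ, V.FinGenInDegreeLE d

/-- `V` is a subquotient of `W`: a quotient of a submodule of `W`. -/
def IsSubquotient (V W : FIModule.{u} k) : Prop :=
  ∃ (U : FIModule.{u} k) (ι : U ⟶ W) (π : U ⟶ V), Mono ι ∧ Epi π

/-- `V` is `d`-small: it is finitely generated and a subquotient of an FI-module which is
finitely generated in degree `≤ d`. -/
def IsSmall (V : FIModule.{u} k) (d : ℕ) : Prop :=
  V.IsFinGen ∧ ∃ W : FIModule.{u} k, W.FinGenInDegreeLE d ∧ V.IsSubquotient W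

end FIModule

/-! ### Finite simplicial complexes and simplicial maps -/

/-- A compact, i.e. finite, simplicial complex, given by its finite vertex set and its set of
simplices (nonempty sets of vertices, closed under nonempty subsets, containing all
singletons). -/
structure FinComplex where
  vertex : Type u
  finite : Finite vertex
  toComplex : AbstractSimplicialComplex vertex

open Classical in
/-- A simplicial map: a map of vertices which carries simplices to simplices. It is allowed to
lower the dimension of a simplex. -/
@[ext]
structure FinComplex.Map (K L : FinComplex.{u}) where
  toFun : K.vertex → L.vertex
  image_mem : ∀ s ∈ K.toComplex.faces, s.image toFun ∈ L.toComplex.faces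

instance : Category FinComplex.{u} where
  Hom := FinComplex.Map
  id K := ⟨id, fun s hs => by simpa using hs⟩
  comp f g := ⟨g.toFun ∘ f.toFun, fun s hs => by
    classical
    rw [← Finset.image_image]
    exact g.image_mem _ (f.image_mem s hs)⟩

/-- An FI-simplicial-complex. -/
abbrev FIComplex := FI ⥤ FinComplex.{u}

/-! ### Free modules and partially defined maps -/

/-- The linear map of free modules induced by a partially defined map `φ` of basis elements:
basis elements on which `φ` is undefined go to `0`. -/
def linearize (k : Type) [CommRing k] {A B : Type u} (φ : A → Option B) :
    (A →₀ k) →ₗ[k] (B →₀ k) :=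
  Finsupp.linearCombination k fun a => (φ a).elim 0 fun b => Finsupp.single b 1

theorem linearize_single (k : Type) [CommRing k] {A B : Type u} (φ : A → Option B) (a : A) :
    linearize k φ (Finsupp.single a 1) = (φ a).elim 0 fun b => Finsupp.single b 1 := by
  simp [linearize]

theorem linearize_some (k : Type) [CommRing k] {A : Type u} :
    linearize k (fun a : A => some a) = LinearMap.id := by
  ext a : 2
  simp [linearize]

theorem linearize_comp (k : Type) [CommRing k] {A B C : Type u} (φ : A → Option B)
    (ψ : B → Option C) :
    linearize k (fun a => (φ a).bind ψ) = (linearize k ψ).comp (linearize k φ) := by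
  ext a : 2
  cases h : φ a <;> simp [linearize, h]

open Classical in
/-- The partially defined map which a partially defined map `φ : A → Option B` induces on
`r`-element subsets: defined on those on which `φ` is everywhere defined and injective, and
then given by the image. -/
def subsetMap {A B : Type u} (φ : A → Option B) (r : ℕ) (S : {S : Finset A // S.card = r}) :
    Option {T : Finset B // T.card = r} :=
  if h : (S.1.biUnion fun a => (φ a).toFinset).card = r then some ⟨_, h⟩ else none

theorem subsetMap_some {A : Type u} (r : ℕ) (S : {S : Finset A // S.card = r}) :
    subsetMap (fun a : A => some a) r S = some S := by
  classical
  have h : (S.1.biUnion fun a => (some a).toFinset) = S.1 := by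
    ext x; simp
  have h1 : (S.1.biUnion fun a => (some a).toFinset).card = r := by rw [h]; exact S.2
  have e1 : subsetMap (fun a : A => some a) r S =
      some ⟨S.1.biUnion fun a => (some a).toFinset, by convert h1⟩ := by
    rw [subsetMap, dif_pos (by convert h1)]
  rw [e1]
  exact congrArg some (Subtype.ext h)

theorem subsetMap_bind {A B C : Type u} (φ : A → Option B) (ψ : B → Option C) (r : ℕ)
    (S : {S : Finset A // S.card = r}) :
    subsetMap (fun a => (φ a).bind ψ) r S = (subsetMap φ r S).bind (subsetMap ψ r) := by
  classical
  have key : (S.1.biUnion fun a => ((φ a).bind ψ).toFinset) =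
      (S.1.biUnion fun a => (φ a).toFinset).biUnion fun b => (ψ b).toFinset := by
    ext x; simp [Option.bind_eq_some_iff]; tauto
  have le1 : ∀ {X Y : Type u} (χ : X → Option Y) (T : Finset X),
      (T.biUnion fun a => (χ a).toFinset).card ≤ T.card := fun χ T => by
    have := Finset.card_biUnion_le_card_mul T (fun a => (χ a).toFinset) 1
      (fun a _ => by cases χ a <;> simp)
    simpa using this
  by_cases h1 : (S.1.biUnion fun a => (φ a).toFinset).card = r
  · have e1 : subsetMap φ r S = some ⟨_, h1⟩ := dif_pos h1
    rw [e1, Option.bind_some]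
    by_cases h2 : ((S.1.biUnion fun a => (φ a).toFinset).biUnion
        fun b => (ψ b).toFinset).card = r
    · have e2 : subsetMap ψ r ⟨_, h1⟩ = some ⟨_, h2⟩ := dif_pos h2
      have h3 : (S.1.biUnion fun a => ((φ a).bind ψ).toFinset).card = r := by rw [key, h2]
      have e3 : subsetMap (fun a => (φ a).bind ψ) r S = some ⟨_, h3⟩ := dif_pos h3
      rw [e2, e3]
      simp only [key]
    · have e2 : subsetMap ψ r ⟨_, h1⟩ = none := dif_neg h2
      have h3 : ¬ (S.1.biUnion fun a => ((φ a).bind ψ).toFinset).card = r := by rwa [key]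
      have e3 : subsetMap (fun a => (φ a).bind ψ) r S = none := dif_neg h3
      rw [e2, e3]
  · have e1 : subsetMap φ r S = none := dif_neg h1
    have h3 : ¬ (S.1.biUnion fun a => ((φ a).bind ψ).toFinset).card = r := by
      rw [key]
      have a1 := le1 φ S.1
      have a2 := le1 ψ (S.1.biUnion fun a => (φ a).toFinset)
      have a3 := S.2
      omega
    have e3 : subsetMap (fun a => (φ a).bind ψ) r S = none := dif_neg h3
    rw [e1, e3, Option.bind_none]

/-! ### The FI-modules of simplices -/

namespace FinComplex

/-- The set `V_i(K)` of `i`-simplices: simplices with exactly `i + 1` vertices. -/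
abbrev Simplex (K : FinComplex.{u}) (i : ℕ) : Type u :=
  {s : Finset K.vertex // s ∈ K.toComplex.faces ∧ s.card = i + 1}

variable {K L M : FinComplex.{u}}

open Classical in
/-- The action of a simplicial map on `i`-simplices, undefined on those `i`-simplices whose
image has smaller dimension. -/
def simplexMap (f : K ⟶ L) (i : ℕ) (s : K.Simplex i) : Option (L.Simplex i) :=
  if h : (s.1.image f.toFun).card = i + 1 then some ⟨_, f.image_mem _ s.2.1, h⟩ else none

theorem simplexMap_id (i : ℕ) (s : K.Simplex i) : simplexMap (𝟙 K) i s = some s := by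
  classical
  have e : s.1.image (𝟙 K : K ⟶ K).toFun = s.1 := Finset.image_id
  have h : (s.1.image (𝟙 K : K ⟶ K).toFun).card = i + 1 := by rw [e]; exact s.2.2
  have e1 : simplexMap (𝟙 K) i s = some ⟨_, (𝟙 K : K ⟶ K).image_mem _ s.2.1, h⟩ := dif_pos h
  rw [e1]
  exact congrArg some (Subtype.ext e)

theorem simplexMap_comp (f : K ⟶ L) (g : L ⟶ M) (i : ℕ) (s : K.Simplex i) :
    simplexMap (f ≫ g) i s = (simplexMap f i s).bind (simplexMap g i) := by
  classical
  have e : s.1.image (f ≫ g).toFun = (s.1.image f.toFun).image g.toFun :=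
    (Finset.image_image (s := s.1) (f := f.toFun) (g := g.toFun)).symm
  by_cases h1 : (s.1.image f.toFun).card = i + 1
  · have e1 : simplexMap f i s = some ⟨_, f.image_mem _ s.2.1, h1⟩ := dif_pos h1
    rw [e1, Option.bind_some]
    by_cases h2 : ((s.1.image f.toFun).image g.toFun).card = i + 1
    · have h3 : (s.1.image (f ≫ g).toFun).card = i + 1 := by rw [e, h2]
      have e2 : simplexMap g i ⟨_, f.image_mem _ s.2.1, h1⟩ =
        some ⟨_, g.image_mem _ (f.image_mem _ s.2.1), h2⟩ := dif_pos h2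
      have e3 : simplexMap (f ≫ g) i s = some ⟨_, (f ≫ g).image_mem _ s.2.1, h3⟩ := dif_pos h3
      rw [e2, e3]
      exact congrArg some (Subtype.ext e)
    · have h3 : ¬ (s.1.image (f ≫ g).toFun).card = i + 1 := by rwa [e]
      have e2 : simplexMap g i ⟨_, f.image_mem _ s.2.1, h1⟩ = none := dif_neg h2
      have e3 : simplexMap (f ≫ g) i s = none := dif_neg h3
      rw [e2, e3]
  · have e1 : simplexMap f i s = none := dif_neg h1
    have h3 : ¬ (s.1.image (f ≫ g).toFun).card = i + 1 := by
      rw [e]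
      have a1 : (s.1.image f.toFun).card ≤ s.1.card := Finset.card_image_le
      have a2 : ((s.1.image f.toFun).image g.toFun).card ≤ (s.1.image f.toFun).card :=
        Finset.card_image_le
      have a3 := s.2.2
      omega
    have e3 : simplexMap (f ≫ g) i s = none := dif_neg h3
    rw [e1, e3, Option.bind_none]

/-- The functor `K ↦ k V_i(K)`, the free module on the `i`-simplices; an `i`-simplex whose image
under a simplicial map has smaller dimension is sent to `0`. -/
def simplexModule (k : Type) [CommRing k] (i : ℕ) : FinComplex.{u} ⥤ ModuleCat.{u} k where
  obj K := ModuleCat.of k (K.Simplex i →₀ k)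
  map f := ModuleCat.ofHom (linearize k (simplexMap f i))
  map_id K := by
    rw [show simplexMap (𝟙 K) i = fun s => some s from funext (simplexMap_id i), linearize_some]
    rfl
  map_comp f g := by
    rw [show simplexMap (f ≫ g) i = _ from funext (simplexMap_comp f g i), linearize_comp]
    rfl

/-- The functor `K ↦ k binom(V_i(K), r)`, the free module on the `r`-element sets of
`i`-simplices; such a set is sent to `0` if its image does not consist of `r` distinct
`i`-simplices. -/
def simplexSubsetModule (k : Type) [CommRing k] (i r : ℕ) :
    FinComplex.{u} ⥤ ModuleCat.{u} k where
  obj K := ModuleCat.of k ({S : Finset (K.Simplex i) // S.card = r} →₀ k)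
  map f := ModuleCat.ofHom (linearize k (subsetMap (simplexMap f i) r))
  map_id K := by
    rw [show simplexMap (𝟙 K) i = fun s => some s from funext (simplexMap_id i),
      show subsetMap (fun s : K.Simplex i => some s) r = fun S => some S from
        funext (subsetMap_some r), linearize_some]
    rfl
  map_comp f g := by
    rw [show simplexMap (f ≫ g) i = _ from funext (simplexMap_comp f g i),
      show subsetMap (fun s => (simplexMap f i s).bind (simplexMap g i)) r = _ from
        funext (subsetMap_bind _ _ r), linearize_comp]
    rfl

/-! ### Simplicial homology, by oriented chains -/

open Classical in
/-- Ordered `i`-simplices: tuples `(v_0, …, v_i)`, possibly with repetitions, of vertices that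
span a simplex. -/
abbrev Tuple (K : FinComplex.{u}) (i : ℕ) : Type u :=
  {t : Fin (i + 1) → K.vertex // Finset.univ.image t ∈ K.toComplex.faces}

/-- The tuple `t ∘ σ`, for any map `σ` of indices. -/
def Tuple.reindex {i j : ℕ} (t : K.Tuple i) (σ : Fin (j + 1) → Fin (i + 1)) : K.Tuple j :=
  ⟨t.1 ∘ σ, by
    classical
    refine (K.toComplex.isRelLowerSet_faces t.2).2 ?_ (by simp)
    intro x hx
    simp only [Finset.mem_image, Finset.mem_univ, true_and, Function.comp] at hx ⊢
    obtain ⟨a, rfl⟩ := hx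
    exact ⟨_, rfl⟩⟩

/-- The image of a tuple under a simplicial map. -/
def Tuple.map {i : ℕ} (f : K ⟶ L) (t : K.Tuple i) : L.Tuple i :=
  ⟨f.toFun ∘ t.1, by
    classical
    rw [← Finset.image_image]
    exact f.image_mem _ t.2⟩

/-- The relations between oriented simplices: a tuple with a repetition is `0`, and permuting a
tuple multiplies it by the sign of the permutation. -/
def orientationRel (K : FinComplex.{u}) (i : ℕ) : Submodule ℤ (K.Tuple i →₀ ℤ) :=
  Submodule.span ℤ
    ({c | ∃ t : K.Tuple i, ¬ Function.Injective t.1 ∧ c = Finsupp.single t 1} ∪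
     {c | ∃ (t : K.Tuple i) (σ : Equiv.Perm (Fin (i + 1))),
        c = Finsupp.single (t.reindex σ) 1 -
          (Equiv.Perm.sign σ : ℤ) • Finsupp.single t 1})

/-- The group `C_i(K)` of oriented simplicial `i`-chains; it is free, with a basis indexed by
`V_i(K)` once an orientation of every `i`-simplex is chosen. -/
abbrev Chain (K : FinComplex.{u}) (i : ℕ) : Type u :=
  (K.Tuple i →₀ ℤ) ⧸ K.orientationRel i

/-- The oriented simplex `[v_0, …, v_i]`. -/
def Tuple.chain {i : ℕ} (t : K.Tuple i) : K.Chain i :=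
  (K.orientationRel i).mkQ (Finsupp.single t 1)

theorem Tuple.chain_eq_zero {i : ℕ} (t : K.Tuple i) (h : ¬ Function.Injective t.1) :
    t.chain = 0 :=
  (Submodule.Quotient.mk_eq_zero _).2 (Submodule.subset_span (Or.inl ⟨t, h, rfl⟩))

theorem Tuple.chain_reindex {i : ℕ} (t : K.Tuple i) (σ : Equiv.Perm (Fin (i + 1))) :
    (t.reindex σ).chain = (Equiv.Perm.sign σ : ℤ) • t.chain := by
  rw [Tuple.chain, Tuple.chain, ← map_smul]
  exact (Submodule.Quotient.eq _).2 (Submodule.subset_span (Or.inr ⟨t, σ, rfl⟩))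

/-- A homomorphism out of `C_i(K)`, given by its values on oriented simplices. -/
def Chain.lift {i : ℕ} {A : Type u} [AddCommGroup A] (φ : K.Tuple i → A)
    (h0 : ∀ t : K.Tuple i, ¬ Function.Injective t.1 → φ t = 0)
    (h1 : ∀ (t : K.Tuple i) (σ : Equiv.Perm (Fin (i + 1))),
      φ (t.reindex σ) = (Equiv.Perm.sign σ : ℤ) • φ t) : K.Chain i →ₗ[ℤ] A :=
  (K.orientationRel i).liftQ (Finsupp.linearCombination ℤ φ) (by
    rw [orientationRel, Submodule.span_le]
    rintro c (⟨t, ht, rfl⟩ | ⟨t, σ, rfl⟩)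
    · simp [h0 t ht]
    · simp [h1 t σ])

theorem Chain.lift_chain {i : ℕ} {A : Type u} [AddCommGroup A] (φ : K.Tuple i → A) (h0) (h1)
    (t : K.Tuple i) : Chain.lift φ h0 h1 t.chain = φ t := by
  simp [Chain.lift, Tuple.chain]

theorem Chain.hom_ext {i : ℕ} {A : Type u} [AddCommGroup A] {φ ψ : K.Chain i →ₗ[ℤ] A}
    (h : ∀ t : K.Tuple i, φ t.chain = ψ t.chain) : φ = ψ := by
  apply Submodule.linearMap_qext
  exact Finsupp.lhom_ext' fun t => LinearMap.ext_ring (h t)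

/-- The `j`-th face `(v_0, …, v_j omitted, …, v_{i+1})` of a tuple. -/
def Tuple.face {i : ℕ} (t : K.Tuple (i + 1)) (j : Fin (i + 2)) : K.Tuple i :=
  t.reindex j.succAbove

/-- The alternating sum of the faces of `[v_0, …, v_{i+1}]`. -/
def Tuple.boundary {i : ℕ} (t : K.Tuple (i + 1)) : K.Chain i :=
  ∑ j : Fin (i + 2), (-1 : ℤ) ^ (j : ℕ) • (t.face j).chain

theorem exists_perm_succAbove {n : ℕ} (σ : Equiv.Perm (Fin (n + 1))) (j : Fin (n + 1)) :
    ∃ τ : Equiv.Perm (Fin n), (∀ a, σ (j.succAbove a) = (σ j).succAbove (τ a)) ∧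
      (Equiv.Perm.sign τ : ℤ) = (-1) ^ (j : ℕ) * (-1) ^ (σ j : ℕ) * Equiv.Perm.sign σ := by
  set π : Equiv.Perm (Fin (n + 1)) := (σ j).cycleRange * σ * j.cycleRange⁻¹ with hπ
  have h0 : π 0 = 0 := by
    have : j.cycleRange⁻¹ 0 = j := Fin.cycleRange_symm_zero j
    rw [hπ, Equiv.Perm.mul_apply, Equiv.Perm.mul_apply, this, Fin.cycleRange_self]
  obtain ⟨⟨p, τ⟩, hτ⟩ := Equiv.Perm.decomposeFin.symm.surjective π
  have hp : p = 0 := by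
    rw [← hτ] at h0
    simpa using h0
  subst hp
  refine ⟨τ, fun a => ?_, ?_⟩
  · have h1 : π a.succ = (τ a).succ := by
      rw [← hτ]; simp
    have h2 : j.cycleRange⁻¹ a.succ = j.succAbove a := Fin.cycleRange_symm_succ j a
    rw [hπ, Equiv.Perm.mul_apply, Equiv.Perm.mul_apply, h2] at h1
    rw [← Fin.cycleRange_symm_succ (σ j), ← h1, Equiv.symm_apply_apply]
  · have h3 : Equiv.Perm.sign π = Equiv.Perm.sign τ := by
      rw [← hτ]; simp
    rw [← h3, hπ]
    simp [Fin.sign_cycleRange]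
    ring

theorem Tuple.chain_face_reindex {i : ℕ} (t : K.Tuple (i + 1))
    (σ : Equiv.Perm (Fin (i + 2))) (j : Fin (i + 2)) :
    (-1 : ℤ) ^ (j : ℕ) • ((t.reindex σ).face j).chain =
      (Equiv.Perm.sign σ : ℤ) • (-1 : ℤ) ^ (σ j : ℕ) • (t.face (σ j)).chain := by
  obtain ⟨τ, h1, h2⟩ := exists_perm_succAbove σ j
  have e : (t.reindex σ).face j = (t.face (σ j)).reindex τ :=
    Subtype.ext (funext fun a => congrArg t.1 (h1 a))
  rw [e, Tuple.chain_reindex, h2, smul_smul, smul_smul]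
  congr 1
  have h3 : ((-1 : ℤ) ^ (j : ℕ)) * (-1) ^ (j : ℕ) = 1 := by
    rw [← mul_pow]; norm_num
  linear_combination ((-1 : ℤ) ^ (σ j : ℕ) * Equiv.Perm.sign σ) * h3

theorem Tuple.boundary_reindex {i : ℕ} (t : K.Tuple (i + 1)) (σ : Equiv.Perm (Fin (i + 2))) :
    (t.reindex σ).boundary = (Equiv.Perm.sign σ : ℤ) • t.boundary := by
  simp only [Tuple.boundary, Tuple.chain_face_reindex, Finset.smul_sum]
  exact Equiv.sum_comp σ fun j =>
    (Equiv.Perm.sign σ : ℤ) • (-1 : ℤ) ^ (j : ℕ) • (t.face j).chain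

theorem Tuple.boundary_eq_zero {i : ℕ} (t : K.Tuple (i + 1)) (h : ¬ Function.Injective t.1) :
    t.boundary = 0 := by
  obtain ⟨a, b, hab, hne⟩ : ∃ a b, t.1 a = t.1 b ∧ a ≠ b := by
    simpa [Function.Injective] using h
  have hz : ∀ k, k ≠ a ∧ k ≠ b → (-1 : ℤ) ^ (k : ℕ) • (t.face k).chain = 0 := by
    rintro k ⟨hka, hkb⟩
    obtain ⟨a1, rfl⟩ := Fin.exists_succAbove_eq hka.symm
    obtain ⟨b1, rfl⟩ := Fin.exists_succAbove_eq hkb.symm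
    rw [Tuple.chain_eq_zero, smul_zero]
    exact fun hinj => hne (congrArg _ (hinj hab))
  have hs : t.reindex (Equiv.swap a b) = t := by
    refine Subtype.ext (funext fun k => ?_)
    change t.1 (Equiv.swap a b k) = t.1 k
    rcases eq_or_ne k a with rfl | h1
    · rw [Equiv.swap_apply_left, hab]
    rcases eq_or_ne k b with rfl | h2
    · rw [Equiv.swap_apply_right, hab]
    · rw [Equiv.swap_apply_of_ne_of_ne h1 h2]
  have h1 := Tuple.chain_face_reindex t (Equiv.swap a b) a
  rw [hs, Equiv.Perm.sign_swap hne, Equiv.swap_apply_left] at h1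
  rw [Tuple.boundary, Fintype.sum_eq_add a b hne hz, h1]
  simp

/-- The boundary map `C_{i+1}(K) → C_i(K)`. -/
def boundary (K : FinComplex.{u}) (i : ℕ) : K.Chain (i + 1) →ₗ[ℤ] K.Chain i :=
  Chain.lift Tuple.boundary Tuple.boundary_eq_zero Tuple.boundary_reindex

theorem boundary_comp_boundary (K : FinComplex.{u}) (i : ℕ) :
    (K.boundary i).comp (K.boundary (i + 1)) = 0 := by
  refine Chain.hom_ext fun t => ?_
  have hb : ∀ {n : ℕ} (t : K.Tuple (n + 1)), K.boundary n t.chain = t.boundary :=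
    fun t => Chain.lift_chain Tuple.boundary Tuple.boundary_eq_zero Tuple.boundary_reindex t
  simp only [LinearMap.comp_apply, hb, Tuple.boundary, map_sum, map_smul, Finset.smul_sum,
    LinearMap.zero_apply]
  rw [Fin.sum_sum_eq_sum_triangle_add]
  refine Finset.sum_eq_zero fun j _ => Finset.sum_eq_zero fun l hl => ?_
  rw [Finset.mem_Ici] at hl
  have e : (t.face l.succ).face j = (t.face j.castSucc).face l := by
    refine Subtype.ext (funext fun a => congrArg t.1 ?_)
    change l.succ.succAbove (j.succAbove a) = j.castSucc.succAbove (l.succAbove a)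
    simp only [Fin.ext_iff, Fin.succAbove, Fin.lt_def]
    have := Fin.le_def.1 hl
    split_ifs <;> simp_all <;> omega
  rw [e, Fin.val_succ, Fin.val_castSucc, smul_smul, smul_smul, ← add_smul]
  convert zero_smul ℤ _
  ring

/-- The simplicial chain complex `⋯ → C_1(K) → C_0(K) → 0` over `ℤ`. -/
def chainComplex (K : FinComplex.{u}) : ChainComplex (ModuleCat.{u} ℤ) ℕ :=
  ChainComplex.of (fun i => ModuleCat.of ℤ (K.Chain i))
    (fun i => ModuleCat.ofHom (K.boundary i)) fun i => by
      rw [← ModuleCat.ofHom_comp, boundary_comp_boundary]; rfl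

theorem chainComplex_d (K : FinComplex.{u}) (i : ℕ) :
    K.chainComplex.d (i + 1) i = ModuleCat.ofHom (K.boundary i) :=
  ChainComplex.of_d (fun i => ModuleCat.of ℤ (K.Chain i))
    (fun i => ModuleCat.ofHom (K.boundary i)) i

/-- The map on chains `[v_0, …, v_i] ↦ [f v_0, …, f v_i]`. -/
def chainMap (f : K ⟶ L) (i : ℕ) : K.Chain i →ₗ[ℤ] L.Chain i :=
  Chain.lift (fun t => (t.map f).chain)
    (fun _ ht => Tuple.chain_eq_zero _ fun h => ht (Function.Injective.of_comp (f := f.toFun) h))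
    (fun t => Tuple.chain_reindex (t.map f))

theorem chainMap_chain (f : K ⟶ L) {i : ℕ} (t : K.Tuple i) :
    chainMap f i t.chain = (t.map f).chain :=
  Chain.lift_chain _ _ _ t

theorem boundary_chain {i : ℕ} (t : K.Tuple (i + 1)) :
    K.boundary i t.chain = ∑ j : Fin (i + 2), (-1 : ℤ) ^ (j : ℕ) • (t.face j).chain :=
  Chain.lift_chain _ _ _ t

theorem boundary_chainMap (f : K ⟶ L) (i : ℕ) :
    (L.boundary i).comp (chainMap f (i + 1)) = (chainMap f i).comp (K.boundary i) := by
  refine Chain.hom_ext fun t => ?_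
  simp only [LinearMap.comp_apply, chainMap_chain, boundary_chain, map_sum, map_smul]
  rfl

/-- The functor sending a complex to its simplicial chain complex. -/
def chainFunctor : FinComplex.{u} ⥤ ChainComplex (ModuleCat.{u} ℤ) ℕ where
  obj K := K.chainComplex
  map f := ChainComplex.ofHom (fun i => ModuleCat.ofHom (chainMap f i)) fun i => by
    rw [chainComplex_d, chainComplex_d]
    exact congrArg ModuleCat.ofHom (boundary_chainMap f i)
  map_id K := by
    ext i : 2
    exact Chain.hom_ext fun t => chainMap_chain (𝟙 K) t
  map_comp f g := by
    ext i : 2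
    exact Chain.hom_ext fun t => (chainMap_chain (f ≫ g) t).trans (by
      change _ = chainMap g i (chainMap f i t.chain)
      rw [chainMap_chain, chainMap_chain]; rfl)

/-- Simplicial homology with integer coefficients, as a functor. -/
def homology (i : ℕ) : FinComplex.{u} ⥤ ModuleCat.{u} ℤ :=
  chainFunctor ⋙ HomologicalComplex.homologyFunctor (ModuleCat.{u} ℤ) (ComplexShape.down ℕ) i

end FinComplex

/-! ### FI-simplicial-complexes -/

namespace FIComplex

/-- The FI-module `ℝ V_i(X_•)`. -/
def simplices (X : FIComplex.{u}) (i : ℕ) : FIModule.{u} ℝ :=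
  X ⋙ FinComplex.simplexModule ℝ i

/-- The FI-module `ℝ binom(V_i(X_•), r)`. -/
def simplexSubsets (X : FIComplex.{u}) (i r : ℕ) : FIModule.{u} ℝ :=
  X ⋙ FinComplex.simplexSubsetModule ℝ i r

/-- The FI-module `H_i(X_•)` over `ℤ`. -/
def homology (X : FIComplex.{u}) (i : ℕ) : FIModule.{u} ℤ :=
  X ⋙ FinComplex.homology i

/-- `X_•` is vertex-stable with stable degree `≤ d`: the FI-module `ℝ V_0(X_•)` is finitely
generated in degree `≤ d`. -/
def IsVertexStable (X : FIComplex.{u}) (d : ℕ) : Prop :=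
  (simplices X 0).FinGenInDegreeLE d

/-- `X_•` is representation stable: every `H_i(X_•)` is a finitely generated FI-module
over `ℤ`. -/
def IsRepresentationStable (X : FIComplex.{u}) : Prop :=
  ∀ i : ℕ, (homology X i).IsFinGen

end FIComplex

end

/-! ### Well-quasi-orders -/

/-! Every vertex of `X_n` is the image of a vertex of some `X_m` with `m ≤ d`, since otherwise its
coordinate would vanish on all of `ℝ V_0(X_n)` (`IsVertexStable.exists_vertex`). For a finite set
`Q`, a `Q`-tuple of vertices of `X_n` involves the images of `|Q|` injections from sets of size at
most `d`. It therefore comes from a subset of `[n]` of size at most `d|Q|`, and the free module on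
all `Q`-tuples of vertices is finitely generated in degree `≤ d|Q|`, over any ring.

Simplicial maps preserve the tuples that span simplices, so these give a submodule. It surjects onto
`ℝ V_i` and onto the oriented chains when `|Q| = i + 1`, and its analogue for `r` tuples surjects
onto the module of `r`-subsets when `|Q| = r(i + 1)`. Homology is a subquotient of chains. This
gives all the subquotient statements.

Finite generation of a subquotient is noetherianity of FI-modules over a noetherian ring
(`FinGenInDegreeLE.exists_finite_generators`), proved by a Gröbner argument. A finitely generated
FI-module is a quotient of a finite sum of free modules on injections `[m_i] → [n]`.
Order-preserving injections act on these bases by strictly monotone maps, and divisibility of basis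
elements is a well-quasi-order by Higman's lemma. Leading coefficient ideals grow along
divisibility, so finitely many basis elements control them all. -/

/-- If no finite set worked, a greedy choice would build a bad sequence. -/
theorem WellQuasiOrdered.exists_finset_forall_exists {α : Type*} {r : α → α → Prop}
    (h : WellQuasiOrdered r) : ∃ s : Finset α, ∀ a, ∃ b ∈ s, r b a := by
  by_contra! H
  obtain ⟨f, -, hf⟩ := exists_seq_of_forall_finset_exists (fun _ : α => True) (fun b a => ¬ r b a)
    fun s _ => (H s).imp fun a ha => ⟨trivial, ha⟩
  obtain ⟨m, n, hmn, hr⟩ := h f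
  exact hf m n hmn hr

/-- Along an `r`-increasing subsequence `L` increases, so it stabilizes by the ascending chain
condition. It is applied with `L` the leading ideal in a noetherian ring. -/
theorem WellQuasiOrdered.and_eq_of_monotone {α β : Type*} {r : α → α → Prop} [IsPreorder α r]
    [PartialOrder β] [WellFoundedGT β] (h : WellQuasiOrdered r) {L : α → β}
    (hL : ∀ a b, r a b → L a ≤ L b) : WellQuasiOrdered fun a b => r a b ∧ L a = L b := by
  intro f
  obtain ⟨g, hg⟩ := h.exists_monotone_subseq f
  obtain ⟨n, hn⟩ := WellFoundedGT.monotone_chain_condition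
    (⟨fun i => L (f (g i)), fun i j hij => hL _ _ (hg i j hij)⟩ : ℕ →o β)
  exact ⟨g n, g (n + 1), g.strictMono n.lt_succ_self, hg _ _ n.le_succ, hn _ n.le_succ⟩

/-! ### Leading ideals -/

section LeadingIdeal

variable {k : Type*} [CommRing k] {β : Type*} [LinearOrder β]

/-- The ideal of the coefficients at `b` of those elements of `N` whose support lies in the
interval of the elements `≤ b`. -/
noncomputable def leadingIdeal (N : Submodule k (β →₀ k)) (b : β) : Ideal k :=
  (N ⊓ Finsupp.supported k k (Set.Iic b)).map (Finsupp.lapply b)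

theorem mem_leadingIdeal {N : Submodule k (β →₀ k)} {b : β} {c : k} :
    c ∈ leadingIdeal N b ↔ ∃ x ∈ N, (∀ b' ∈ x.support, b' ≤ b) ∧ x b = c := by
  simp only [leadingIdeal, Submodule.mem_map, Submodule.mem_inf, Finsupp.mem_supported, and_assoc]
  rfl

/-- Division with remainder: subtracting from `x` an element of `N'` with the same coefficient at
the bound `b` leaves an element of `N` supported strictly below `b`, and well-founded induction
applies. -/
theorem le_of_leadingIdeal_le [WellFoundedLT β] {N N' : Submodule k (β →₀ k)} (hle : N' ≤ N)
    (h : ∀ b, leadingIdeal N b ≤ leadingIdeal N' b) : N ≤ N' := by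
  have key : ∀ b, ∀ x ∈ N, (∀ b' ∈ x.support, b' ≤ b) → x ∈ N' := by
    intro b
    induction b using WellFoundedLT.induction with
    | ind b ih =>
      intro x hx hxb
      obtain ⟨y, hy, hyb, hyx⟩ := mem_leadingIdeal.1 (h b (mem_leadingIdeal.2 ⟨x, hx, hxb, rfl⟩))
      rw [← sub_add_cancel x y]
      refine N'.add_mem ?_ hy
      rcases (x - y).support.eq_empty_or_nonempty with h0 | h0
      · rw [Finsupp.support_eq_empty.1 h0]
        exact N'.zero_mem
      · refine ih ((x - y).support.max' h0) ?_ _ (N.sub_mem hx (hle hy)) fun b' hb' =>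
          Finset.le_max' _ _ hb'
        have hm := Finset.max'_mem _ h0
        refine lt_of_le_of_ne ?_ fun hb => ?_
        · rcases Finset.mem_union.1 (Finsupp.support_sub hm) with h1 | h1
          exacts [hxb _ h1, hyb _ h1]
        · rw [hb, Finsupp.mem_support_iff, Finsupp.sub_apply, hyx, sub_self] at hm
          exact hm rfl
  intro x hx
  rcases x.support.eq_empty_or_nonempty with h0 | h0
  · rw [Finsupp.support_eq_empty.1 h0]
    exact N'.zero_mem
  · exact key (x.support.max' h0) x hx fun b' hb' => Finset.le_max' _ _ hb'

theorem apply_mem_leadingIdeal_of_mapDomain {β' : Type*} [LinearOrder β']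
    {N' : Submodule k (β' →₀ k)} {φ : β → β'} (hφ : StrictMono φ)
    {b : β} {x : β →₀ k} (hxb : ∀ b' ∈ x.support, b' ≤ b) (hx : Finsupp.mapDomain φ x ∈ N') :
    x b ∈ leadingIdeal N' (φ b) := by
  classical
  refine mem_leadingIdeal.2 ⟨_, hx, fun b' hb' => ?_, Finsupp.mapDomain_apply hφ.injective x b⟩
  obtain ⟨a, ha, rfl⟩ := Finset.mem_image.1 (Finsupp.mapDomain_support hb')
  exact hφ.monotone (hxb a ha)

end LeadingIdeal

/-- A family of submodules of free modules, stable under the order embeddings of finite ordinals,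
is finitely generated as soon as these act on the bases by strictly monotone maps and
divisibility of basis elements is a well-quasi-order. -/
theorem exists_finite_generators {k : Type*} [CommRing k] [IsNoetherianRing k] {B : ℕ → Type*}
    [∀ n, LinearOrder (B n)] [∀ n, WellFoundedLT (B n)]
    (act : ∀ m n : ℕ, (Fin m ↪o Fin n) → B m → B n) (hmono : ∀ m n g, StrictMono (act m n g))
    [IsPreorder (Σ n, B n) fun a b => ∃ g, act a.1 b.1 g a.2 = b.2]
    (hwqo : WellQuasiOrdered fun a b : Σ n, B n => ∃ g, act a.1 b.1 g a.2 = b.2)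
    (N : ∀ n, Submodule k (B n →₀ k))
    (hN : ∀ m n g, ∀ x ∈ N m, Finsupp.mapDomain (act m n g) x ∈ N n) :
    ∃ S : Set (Σ n, B n →₀ k), S.Finite ∧ (∀ x ∈ S, x.2 ∈ N x.1) ∧
      ∀ n, N n ≤ Submodule.span k
        {y | ∃ x ∈ S, ∃ g, y = Finsupp.mapDomain (act x.1 n g) x.2} := by
  have hL : ∀ a b : Σ n, B n, (∃ g, act a.1 b.1 g a.2 = b.2) →
      leadingIdeal (N a.1) a.2 ≤ leadingIdeal (N b.1) b.2 := by
    rintro ⟨m, a⟩ ⟨n, b⟩ ⟨g, hg⟩ c hc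
    obtain ⟨x, hx, hxa, rfl⟩ := mem_leadingIdeal.1 hc
    dsimp only at g hg ⊢
    rw [← hg]
    exact apply_mem_leadingIdeal_of_mapDomain (hmono m n g) hxa (hN m n g x hx)
  -- Every basis element is divisible by a member of `F` with the same leading ideal.
  obtain ⟨F, hF⟩ := (hwqo.and_eq_of_monotone hL).exists_finset_forall_exists
  -- A finite generating set of the leading ideal is lifted to elements of `N` having those leading
  -- coefficients.
  have hgen : ∀ a : Σ n, B n, ∃ T : Set (B a.1 →₀ k), T.Finite ∧
      (∀ x ∈ T, x ∈ N a.1 ∧ ∀ b ∈ x.support, b ≤ a.2) ∧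
      leadingIdeal (N a.1) a.2 = Ideal.span ((fun x => x a.2) '' T) := by
    intro a
    obtain ⟨G, hG⟩ := IsNoetherian.noetherian (leadingIdeal (N a.1) a.2)
    have hw : ∀ c ∈ G, ∃ x ∈ N a.1, (∀ b' ∈ x.support, b' ≤ a.2) ∧ x a.2 = c := fun c hc =>
      mem_leadingIdeal.1 (hG ▸ Submodule.subset_span hc)
    choose! w hw1 hw2 hw3 using hw
    refine ⟨w '' G, G.finite_toSet.image w, ?_, ?_⟩
    · rintro _ ⟨c, hc, rfl⟩
      exact ⟨hw1 c hc, hw2 c hc⟩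
    · rw [← hG, Set.image_image, Set.image_congr (g := id) fun c hc => hw3 c hc, Set.image_id]
  choose T hT1 hT2 hT3 using hgen
  refine ⟨⋃ a ∈ F, Sigma.mk a.1 '' T a, F.finite_toSet.biUnion fun a _ => (hT1 a).image _, ?_, ?_⟩
  · intro x hx
    simp only [Set.mem_iUnion] at hx
    obtain ⟨a, -, y, hy, rfl⟩ := hx
    exact (hT2 a y hy).1
  intro n
  refine le_of_leadingIdeal_le ?_ fun b => ?_
  · rw [Submodule.span_le]
    rintro _ ⟨x, hx, g, rfl⟩
    simp only [Set.mem_iUnion] at hx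
    obtain ⟨a, -, y, hy, rfl⟩ := hx
    exact hN _ _ g _ (hT2 a y hy).1
  -- The translates by `g` of the elements of `T a` keep their leading coefficients, now at `b`, and
  -- these generate the whole leading ideal at `b`.
  · obtain ⟨a, haF, ⟨g, hg⟩, hab⟩ := hF ⟨n, b⟩
    dsimp only at g hg hab
    rw [← hab, hT3, Ideal.span_le]
    rintro _ ⟨x, hx, rfl⟩
    rw [SetLike.mem_coe, ← hg]
    refine apply_mem_leadingIdeal_of_mapDomain (hmono _ _ g) (hT2 a x hx).2
      (Submodule.subset_span ⟨⟨a.1, x⟩, ?_, g, rfl⟩)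
    simp only [Set.mem_iUnion]
    exact ⟨a, haF, x, hx, rfl⟩

/-! ### Divisibility of tuples of elements of finite ordinals -/

theorem List.exists_orderEmbedding_of_ofFn_sublist {α : Type*} {m n : ℕ} {a : Fin m → α}
    {b : Fin n → α} (h : (List.ofFn a).Sublist (List.ofFn b)) :
    ∃ g : Fin m ↪o Fin n, ∀ i, a i = b (g i) := by
  obtain ⟨g, hg⟩ := List.sublist_iff_exists_fin_orderEmbedding_get_eq.1 h
  refine ⟨(Fin.castOrderIso List.length_ofFn.symm).toOrderEmbedding.trans
    (g.trans (Fin.castOrderIso List.length_ofFn).toOrderEmbedding), fun i => ?_⟩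
  have := hg (Fin.cast List.length_ofFn.symm i)
  rw [List.get_ofFn, List.get_ofFn] at this
  exact this

/-- A map `Fin m → Fin n` is encoded as the word of length `n` whose letter at `p` is its fibre over
`p`. The alphabet is finite, so Higman's lemma yields a subword, and the positions of its letters
form an order embedding that matches fibres. -/
theorem wellQuasiOrdered_tuple (m : ℕ) :
    WellQuasiOrdered fun a b : Σ n, (Fin m → Fin n) =>
      ∃ g : Fin a.1 ↪o Fin b.1, ∀ q, g (a.2 q) = b.2 q := by
  intro f
  let w : ℕ → List (Set (Fin m)) := fun j => List.ofFn fun p => {q | (f j).2 q = p}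
  have hH := Set.PartiallyWellOrderedOn.partiallyWellOrderedOn_sublistForall₂
    (fun a b : Set (Fin m) => a = b) Set.finite_univ.partiallyWellOrderedOn
  obtain ⟨i, j, hij, h⟩ := hH.exists_lt (f := w) fun _ _ _ => Set.mem_univ _
  obtain ⟨l, hl, hs⟩ := List.sublistForall₂_iff.1 h
  rw [List.forall₂_eq_eq_eq] at hl
  subst hl
  obtain ⟨g, hg⟩ := List.exists_orderEmbedding_of_ofFn_sublist hs
  refine ⟨i, j, hij, g, fun q => ?_⟩
  have : q ∈ {q' | (f j).2 q' = g ((f i).2 q)} := hg _ ▸ rfl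
  exact this.symm

/-- The disjoint union over `i` of the sets of injections `Fin (m i) → Fin n`, ordered
lexicographically. -/
abbrev IndexedInjection {s : ℕ} (m : Fin s → ℕ) (n : ℕ) : Type :=
  {x : Σₗ i, Lex (Fin (m i) → Fin n) // Function.Injective (ofLex (ofLex x).2)}

namespace IndexedInjection

variable {s : ℕ} {m : Fin s → ℕ}

/-- The index of an indexed injection. -/
def index {n : ℕ} (x : IndexedInjection m n) : Fin s := (ofLex x.1).1

/-- The injection underlying an indexed injection. -/
def toEmbedding {n : ℕ} (x : IndexedInjection m n) : Fin (m x.index) ↪ Fin n :=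
  ⟨ofLex (ofLex x.1).2, x.2⟩

/-- The indexed injection with given index and injection. -/
def mk {n : ℕ} (i : Fin s) (a : Fin (m i) ↪ Fin n) : IndexedInjection m n :=
  ⟨toLex ⟨i, toLex a⟩, a.injective⟩

theorem exists_eq_mk {n : ℕ} (x : IndexedInjection m n) : ∃ i a, x = mk i a :=
  ⟨x.index, x.toEmbedding, rfl⟩

/-- Composition of an indexed injection with an order embedding. -/
def act (n n' : ℕ) (g : Fin n ↪o Fin n') (x : IndexedInjection m n) : IndexedInjection m n' :=
  mk x.index (x.toEmbedding.trans g.toEmbedding)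

/-- An order embedding preserves the first place of difference and the comparison there. An
arbitrary injection need not, which is why only order embeddings act. -/
theorem act_strictMono (n n' : ℕ) (g : Fin n ↪o Fin n') :
    StrictMono (act (m := m) n n' g) := by
  rintro ⟨⟨i, a⟩, ha⟩ ⟨⟨j, b⟩, hb⟩ h
  have h' : (toLex (⟨i, a⟩ : Σ i, Lex (Fin (m i) → Fin n)) : Σₗ i, Lex (Fin (m i) → Fin n))
    < toLex ⟨j, b⟩ := h
  change (toLex (⟨i, toLex (g ∘ ofLex a)⟩ : Σ i, Lex (Fin (m i) → Fin n')) :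
    Σₗ i, Lex (Fin (m i) → Fin n')) < toLex ⟨j, toLex (g ∘ ofLex b)⟩
  rcases h' with ⟨_, _, hij⟩ | ⟨_, _, q, hq, hlt⟩
  · exact Sigma.Lex.left _ _ hij
  · exact Sigma.Lex.right _ _ ⟨q, fun r hr => congrArg g (hq r hr), g.lt_iff_lt.2 hlt⟩

instance isPreorder_divides : IsPreorder (Σ n, IndexedInjection m n)
    fun a b => ∃ g, act a.1 b.1 g a.2 = b.2 where
  refl a := ⟨RelEmbedding.refl _, rfl⟩
  trans a b c := by
    rintro ⟨g, hg⟩ ⟨g', hg'⟩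
    exact ⟨g.trans g', hg' ▸ hg ▸ rfl⟩

/-- There are finitely many indices, so a subsequence has constant index and
`wellQuasiOrdered_tuple` applies to it. -/
theorem wellQuasiOrdered_divides (m : Fin s → ℕ) :
    WellQuasiOrdered fun a b : Σ n, IndexedInjection m n => ∃ g, act a.1 b.1 g a.2 = b.2 := by
  intro f
  obtain ⟨g, hg⟩ := (Finite.wellQuasiOrdered (fun a b : Fin s => a = b)).exists_monotone_subseq
    fun j => (f j).2.index
  have hf : ∀ j, ∃ a : Fin (m (f (g 0)).2.index) ↪ Fin (f (g j)).1, (f (g j)).2 = mk _ a := by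
    intro j
    obtain ⟨i, a, ha⟩ := (f (g j)).2.exists_eq_mk
    obtain rfl : (f (g 0)).2.index = i := (hg 0 j j.zero_le).trans (by rw [ha]; rfl)
    exact ⟨a, ha⟩
  choose a ha using hf
  obtain ⟨j, j', hj, h, hh⟩ := wellQuasiOrdered_tuple _ fun j => ⟨(f (g j)).1, a j⟩
  refine ⟨g j, g j', g.strictMono hj, h, ?_⟩
  have hact : act _ _ h (f (g j)).2 = act _ _ h (mk _ (a j)) := congrArg _ (ha j)
  exact hact.trans ((congrArg (mk _) (Function.Embedding.ext hh)).trans (ha j').symm)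

end IndexedInjection

/-! ### FI-modules over noetherian rings -/

namespace FIModule

variable {k : Type} [CommRing k]

theorem IsFinGen.of_finite {V : FIModule.{u} k} {S : Set (Σ m : FI, V.obj m)} (hS : S.Finite)
    (h : ∀ n : FI, Submodule.span k
      {y : V.obj n | ∃ x ∈ S, ∃ f : x.1 ⟶ n, y = (V.map f).hom x.2} = ⊤) : V.IsFinGen := by
  obtain ⟨d, hd⟩ := (hS.image fun x => x.1.size).bddAbove
  exact ⟨d, S, hS, fun x hx => hd ⟨x, hx, rfl⟩, h⟩

theorem FinGenInDegreeLE.of_epi {V W : FIModule.{u} k} (π : W ⟶ V) [Epi π] {d : ℕ}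
    (h : W.FinGenInDegreeLE d) : V.FinGenInDegreeLE d := by
  obtain ⟨S, hS, hd, hspan⟩ := h
  refine ⟨(fun x => ⟨x.1, (π.app x.1).hom x.2⟩) '' S, hS.image _, ?_, fun n => ?_⟩
  · rintro _ ⟨x, hx, rfl⟩
    exact hd x hx
  · have hsurj : Function.Surjective (π.app n).hom :=
      (ModuleCat.epi_iff_surjective _).1 inferInstance
    rw [← top_le_iff, ← LinearMap.range_eq_top.2 hsurj, LinearMap.range_eq_map, ← hspan n,
      Submodule.map_span]
    refine Submodule.span_mono ?_
    rintro _ ⟨_, ⟨x, hx, f, rfl⟩, rfl⟩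
    exact ⟨_, ⟨x, hx, rfl⟩, f, NatTrans.naturality_apply π f x.2⟩

/-- A finitely generated FI-module over a noetherian ring is noetherian. -/
theorem FinGenInDegreeLE.exists_finite_generators [IsNoetherianRing k] {W : FIModule.{u} k}
    {d : ℕ} (hW : W.FinGenInDegreeLE d) (N : ∀ n : FI, Submodule k (W.obj n))
    (hN : ∀ (m n : FI) (f : m ⟶ n), ∀ x ∈ N m, (W.map f).hom x ∈ N n) :
    ∃ S : Set (Σ n : FI, W.obj n), S.Finite ∧ (∀ x ∈ S, x.2 ∈ N x.1) ∧
      ∀ n, N n ≤ Submodule.span k {y | ∃ x ∈ S, ∃ f : x.1 ⟶ n, y = (W.map f).hom x.2} := by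
  obtain ⟨S, hS, -, hspan⟩ := hW
  obtain ⟨s, v, hv⟩ : ∃ (s : ℕ) (v : Fin s → Σ n : FI, W.obj n), Set.range v = S := by
    have := hS.to_subtype
    obtain ⟨s, ⟨e⟩⟩ := Finite.exists_equiv_fin S
    exact ⟨s, fun i => e.symm i, (e.symm.surjective.range_comp Subtype.val).trans Subtype.range_coe⟩
  let m : Fin s → ℕ := fun i => (v i).1.size
  let ev : ∀ n : ℕ, IndexedInjection m n → W.obj ⟨n⟩ := fun n b =>
    (W.map (X := (v b.index).1) (Y := ⟨n⟩) b.toEmbedding).hom (v b.index).2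
  -- The presentation of `W` by free modules, one for each generator `v i`. It is compatible with
  -- order embeddings, and `N` is pulled back along it.
  let φ : ∀ n : ℕ, (IndexedInjection m n →₀ k) →ₗ[k] W.obj ⟨n⟩ := fun n =>
    Finsupp.linearCombination k (ev n)
  have hev : ∀ (n n' : ℕ) (g : Fin n ↪o Fin n') (b : IndexedInjection m n),
      ev n' (b.act n n' g) = (W.map (X := ⟨n⟩) (Y := ⟨n'⟩) g.toEmbedding).hom (ev n b) := by
    intro n n' g b
    exact congrArg (fun h => h.hom (v b.index).2)
      (W.map_comp (X := (v b.index).1) (Y := ⟨n⟩) (Z := ⟨n'⟩) b.toEmbedding g.toEmbedding)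
  have hφ : ∀ (n n' : ℕ) (g : Fin n ↪o Fin n') (x : IndexedInjection m n →₀ k),
      φ n' (Finsupp.mapDomain (IndexedInjection.act n n' g) x) =
        (W.map (X := ⟨n⟩) (Y := ⟨n'⟩) g.toEmbedding).hom (φ n x) := by
    intro n n' g x
    simp only [φ, Finsupp.linearCombination_mapDomain]
    rw [Finsupp.linearCombination_apply, Finsupp.linearCombination_apply, map_finsuppSum]
    exact Finsupp.sum_congr fun b _ => by rw [map_smul, ← hev]; rfl
  have hsurj : ∀ n, Function.Surjective (φ n) := by
    intro n
    rw [← LinearMap.range_eq_top, ← top_le_iff, ← hspan ⟨n⟩, Submodule.span_le]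
    rintro _ ⟨x, hx, f, rfl⟩
    obtain ⟨i, rfl⟩ : x ∈ Set.range v := hv ▸ hx
    refine ⟨Finsupp.single (IndexedInjection.mk i f) 1, ?_⟩
    simp only [φ, Finsupp.linearCombination_single, one_smul]
    rfl
  obtain ⟨T, hT, hTN, hTspan⟩ := _root_.exists_finite_generators (k := k)
    (IndexedInjection.act (m := m)) IndexedInjection.act_strictMono
    (IndexedInjection.wellQuasiOrdered_divides m) (fun n => (N ⟨n⟩).comap (φ n))
    (fun n n' g x hx => by
      rw [Submodule.mem_comap, hφ]
      exact hN _ _ _ _ hx)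
  refine ⟨(fun x => ⟨⟨x.1⟩, φ x.1 x.2⟩) '' T, hT.image _, ?_, fun n x hx => ?_⟩
  · rintro _ ⟨x, hx, rfl⟩
    exact hTN x hx
  · obtain ⟨y, rfl⟩ := hsurj n.size x
    have hy := Submodule.mem_map_of_mem (f := φ n.size) (hTspan n.size hx)
    rw [Submodule.map_span] at hy
    refine Submodule.span_mono ?_ hy
    rintro _ ⟨_, ⟨z, hz, g, rfl⟩, rfl⟩
    -- Order embeddings alone already generate; allowing all injections only enlarges the span.
    exact ⟨_, ⟨z, hz, rfl⟩, g.toEmbedding, hφ _ _ g z.2⟩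

theorem FinGenInDegreeLE.isFinGen_of_mono [IsNoetherianRing k] {U W : FIModule.{u} k}
    (ι : U ⟶ W) [Mono ι] {d : ℕ} (hW : W.FinGenInDegreeLE d) : U.IsFinGen := by
  have hinj : ∀ n, Function.Injective (ι.app n).hom := fun n =>
    (ModuleCat.mono_iff_injective _).1 inferInstance
  obtain ⟨S, hS, hSN, hspan⟩ := hW.exists_finite_generators
    (fun n => LinearMap.range (ι.app n).hom) (by
      rintro m n f _ ⟨x, rfl⟩
      exact ⟨_, NatTrans.naturality_apply ι f x⟩)
  choose! w hw using hSN
  refine .of_finite (S := (fun x => ⟨x.1, w x⟩) '' S) (hS.image _) fun n => ?_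
  rw [← top_le_iff, ← Submodule.map_le_map_iff_of_injective (hinj n), Submodule.map_span,
    ← LinearMap.range_eq_map]
  refine (hspan n).trans (Submodule.span_mono ?_)
  rintro _ ⟨x, hx, f, rfl⟩
  refine ⟨_, ⟨_, ⟨x, hx, rfl⟩, f, rfl⟩, ?_⟩
  rw [← hw x hx]
  exact NatTrans.naturality_apply ι f (w x)

theorem IsSubquotient.isSmall [IsNoetherianRing k] {V W : FIModule.{u} k} {d : ℕ}
    (h : V.IsSubquotient W) (hW : W.FinGenInDegreeLE d) : V.IsSmall d := by
  refine ⟨?_, W, hW, h⟩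
  obtain ⟨U, ι, π, _, _⟩ := h
  obtain ⟨e, he⟩ := hW.isFinGen_of_mono ι
  exact ⟨e, he.of_epi π⟩

/-- The pullback of `ι` and `π'` works because monomorphisms and, in an abelian category,
epimorphisms are stable under pullback. -/
theorem IsSubquotient.trans {V W W' : FIModule.{u} k} (h : V.IsSubquotient W)
    (h' : W.IsSubquotient W') : V.IsSubquotient W' := by
  obtain ⟨U, ι, π, _, _⟩ := h
  obtain ⟨U', ι', π', _, _⟩ := h'
  exact ⟨Limits.pullback ι π', Limits.pullback.snd ι π' ≫ ι', Limits.pullback.fst ι π' ≫ π,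
    mono_comp _ _, epi_comp _ _⟩

end FIModule

noncomputable section

/-! ### Partially defined maps -/

section

variable {k : Type} [CommRing k] {A B : Type u}

theorem linearize_some_comp (g : A → B) :
    linearize k (fun a => some (g a)) = Finsupp.lmapDomain k k g := by
  ext a : 2
  simp [linearize]

theorem linearize_comm {C D : Type u} {φ : A → Option B} {ψ : B → Option D} {φ' : A → Option C}
    {ψ' : C → Option D} (h : ∀ a, (φ a).bind ψ = (φ' a).bind ψ') :
    (linearize k ψ).comp (linearize k φ) = (linearize k ψ').comp (linearize k φ') := by
  rw [← linearize_comp, ← linearize_comp, funext h]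

theorem linearize_surjective {φ : A → Option B} (h : ∀ b, ∃ a, φ a = some b) :
    Function.Surjective (linearize k φ) := by
  rw [← LinearMap.range_eq_top, eq_top_iff]
  intro x _
  induction x using Finsupp.induction_linear with
  | zero => exact zero_mem _
  | add x y hx hy => exact add_mem (hx trivial) (hy trivial)
  | single b c =>
    obtain ⟨a, ha⟩ := h b
    exact ⟨Finsupp.single a c, by simp [linearize, ha]⟩

theorem linearize_apply_eq_zero {φ : A → Option B} {b : B} (h : ∀ a, φ a ≠ some b)
    (x : A →₀ k) : linearize k φ x b = 0 := by
  classical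
  induction x using Finsupp.induction_linear with
  | zero => simp
  | add x y hx hy => rw [map_add, Finsupp.add_apply, hx, hy, add_zero]
  | single a c =>
    cases hφ : φ a with
    | none => simp [linearize, hφ]
    | some b' =>
      have hne : b' ≠ b := fun e => h a (e ▸ hφ)
      simp [linearize, hφ, hne]

theorem subsetMap_eq_some_iff [DecidableEq B] {φ : A → Option B} {r : ℕ}
    {S : {S : Finset A // S.card = r}} {T : {T : Finset B // T.card = r}} :
    subsetMap φ r S = some T ↔ (S.1.biUnion fun a => (φ a).toFinset) = T.1 := by
  obtain rfl : ‹DecidableEq B› = fun a b => Classical.propDecidable (a = b) :=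
    Subsingleton.elim _ _
  constructor
  · intro h
    rw [subsetMap] at h
    split_ifs at h with hc
    exact congrArg Subtype.val (Option.some.inj h)
  · intro h
    have hc := h ▸ T.2
    exact (dif_pos hc).trans (congrArg some (Subtype.ext h))

end

/-! ### Simplices, sets of simplices and chains as quotients of modules of vertex families -/

namespace FinComplex

variable {K L : FinComplex.{u}}

theorem simplexMap_eq_some_iff [DecidableEq L.vertex] {f : K ⟶ L} {i : ℕ} {s : K.Simplex i}
    {s' : L.Simplex i} : simplexMap f i s = some s' ↔ s.1.image f.toFun = s'.1 := by
  obtain rfl : ‹DecidableEq L.vertex› = fun a b => Classical.propDecidable (a = b) :=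
    Subsingleton.elim _ _
  constructor
  · intro h
    rw [simplexMap] at h
    split_ifs at h with hc
    exact congrArg Subtype.val (Option.some.inj h)
  · intro h
    have hc := h ▸ s'.2.2
    exact (dif_pos hc).trans (congrArg some (Subtype.ext h))

open Classical in
/-- The simplex spanned by the vertices of a tuple, defined if these are distinct. -/
def Tuple.simplex {i : ℕ} (t : K.Tuple i) : Option (K.Simplex i) :=
  if h : (Finset.univ.image t.1).card = i + 1 then some ⟨_, t.2, h⟩ else none

theorem Tuple.simplex_eq_some_iff [DecidableEq K.vertex] {i : ℕ} {t : K.Tuple i}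
    {s : K.Simplex i} : t.simplex = some s ↔ Finset.univ.image t.1 = s.1 := by
  obtain rfl : ‹DecidableEq K.vertex› = fun a b => Classical.propDecidable (a = b) :=
    Subsingleton.elim _ _
  constructor
  · intro h
    rw [simplex] at h
    split_ifs at h with hc
    exact congrArg Subtype.val (Option.some.inj h)
  · intro h
    have hc := h ▸ s.2.2
    exact (dif_pos hc).trans (congrArg some (Subtype.ext h))

/-- Both sides are undefined together: if the image tuple has `i + 1` distinct vertices, then so had
`t`, since taking images cannot increase cardinality. -/
theorem Tuple.simplex_map (f : K ⟶ L) {i : ℕ} (t : K.Tuple i) :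
    (t.map f).simplex = t.simplex.bind (simplexMap f i) := by
  classical
  ext s
  rw [Option.bind_eq_some_iff, simplex_eq_some_iff,
    show (t.map f).1 = f.toFun ∘ t.1 from rfl, ← Finset.image_image]
  constructor
  · intro h
    have h1 : (Finset.univ.image t.1).card ≤ i + 1 := by
      simpa using Finset.card_image_le (s := Finset.univ) (f := t.1)
    have h2 : s.1.card ≤ (Finset.univ.image t.1).card := h ▸ Finset.card_image_le
    refine ⟨⟨Finset.univ.image t.1, by convert t.2, h1.antisymm (by rwa [s.2.2] at h2)⟩,
      simplex_eq_some_iff.2 rfl, simplexMap_eq_some_iff.2 h⟩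
  · rintro ⟨s', h1, h2⟩
    rw [simplex_eq_some_iff.1 h1, simplexMap_eq_some_iff.1 h2]

theorem Tuple.exists_simplex_eq {i : ℕ} (s : K.Simplex i) :
    ∃ t : K.Tuple i, t.simplex = some s := by
  classical
  have e := s.1.equivFinOfCardEq s.2.2
  have h : Finset.univ.image (fun q => (e.symm q : K.vertex)) = s.1 := by
    ext v
    simp only [Finset.mem_image, Finset.mem_univ, true_and]
    exact ⟨by rintro ⟨q, rfl⟩; exact (e.symm q).2, fun hv => ⟨e ⟨v, hv⟩, by simp⟩⟩
  refine ⟨⟨fun q => e.symm q, ?_⟩, simplex_eq_some_iff.2 h⟩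
  convert s.2.1

/-- The set of `r` simplices spanned by `r` tuples, defined if these are distinct. -/
def simplexSet {i r : ℕ} (T : Fin r → K.Tuple i) :
    Option {S : Finset (K.Simplex i) // S.card = r} :=
  -- The tuples form a partial map on the index set, so that naturality reduces to `subsetMap_bind`;
  -- `ULift` puts the indices in the universe `subsetMap` expects.
  subsetMap (fun j : ULift.{u} (Fin r) => (T j.down).simplex) r ⟨Finset.univ, by simp⟩

theorem simplexSet_map (f : K ⟶ L) {i r : ℕ} (T : Fin r → K.Tuple i) :
    simplexSet (fun j => (T j).map f) =
      (simplexSet T).bind (subsetMap (simplexMap f i) r) := by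
  rw [simplexSet, simplexSet, ← subsetMap_bind]
  simp only [Tuple.simplex_map]

theorem exists_simplexSet_eq {i r : ℕ} (S : {S : Finset (K.Simplex i) // S.card = r}) :
    ∃ T : Fin r → K.Tuple i, simplexSet T = some S := by
  classical
  have e := S.1.equivFinOfCardEq S.2
  choose t ht using fun s : K.Simplex i => Tuple.exists_simplex_eq s
  refine ⟨fun j => t (e.symm j), subsetMap_eq_some_iff.2 ?_⟩
  ext s
  simp only [ht, Finset.mem_biUnion, Finset.mem_univ, true_and, Option.mem_toFinset,
    Option.mem_def, Option.some.injEq]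
  exact ⟨by rintro ⟨q, rfl⟩; exact (e.symm q.down).2, fun hs => ⟨⟨e ⟨s, hs⟩⟩, by simp⟩⟩

/-- The families of vertices of `K` indexed by `Q` which satisfy `p`. -/
abbrev Family {Q : Type} (p : ∀ K : FinComplex.{u}, (Q → K.vertex) → Prop) (K : FinComplex.{u}) :
    Type u :=
  {t : Q → K.vertex // p K t}

/-- A property of families of vertices is stable under simplicial maps. -/
def IsStable {Q : Type} (p : ∀ K : FinComplex.{u}, (Q → K.vertex) → Prop) : Prop :=
  ∀ (K L : FinComplex.{u}) (f : K ⟶ L) (t : Q → K.vertex), p K t → p L (f.toFun ∘ t)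

/-- The image of a family of vertices under a simplicial map. -/
def Family.map {Q : Type} {p : ∀ K : FinComplex.{u}, (Q → K.vertex) → Prop} (hp : IsStable p)
    (f : K ⟶ L) (t : Family p K) : Family p L :=
  ⟨f.toFun ∘ t.1, hp K L f t.1 t.2⟩

/-- The functor sending `K` to the free module on the families of vertices indexed by `Q` which
satisfy a property `p` that is stable under simplicial maps. -/
def familyModule (k : Type) [CommRing k] {Q : Type}
    {p : ∀ K : FinComplex.{u}, (Q → K.vertex) → Prop} (hp : IsStable p) :
    FinComplex.{u} ⥤ ModuleCat.{u} k where
  obj K := ModuleCat.of k (Family p K →₀ k)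
  map f := ModuleCat.ofHom (linearize k fun t => some (t.map hp f))
  map_id _ := congrArg ModuleCat.ofHom (linearize_some k)
  map_comp f g := congrArg ModuleCat.ofHom
    (linearize_comp k (fun t => some (Family.map hp f t)) fun t => some (t.map hp g))

theorem isStable_true (Q : Type) : IsStable.{u} (Q := Q) fun _ _ => True :=
  fun _ _ _ _ _ => trivial

/-- The functor sending `K` to the free module on all families of vertices indexed by `Q`. -/
abbrev vertexFamilyModule (k : Type) [CommRing k] (Q : Type) :
    FinComplex.{u} ⥤ ModuleCat.{u} k :=
  familyModule k (isStable_true Q)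

/-- The inclusion of `familyModule` into `vertexFamilyModule`. -/
def familyInclusion (k : Type) [CommRing k] {Q : Type}
    {p : ∀ K : FinComplex.{u}, (Q → K.vertex) → Prop} (hp : IsStable p) :
    familyModule k hp ⟶ vertexFamilyModule k Q where
  app K := ModuleCat.ofHom (linearize k fun t : Family p K =>
    some (⟨t.1, trivial⟩ : Family (fun _ _ => True) K))
  naturality _ _ _ := ModuleCat.hom_ext (linearize_comm fun _ => rfl)

theorem familyInclusion_app_injective (k : Type) [CommRing k] {Q : Type}
    {p : ∀ K : FinComplex.{u}, (Q → K.vertex) → Prop} (hp : IsStable p) (K : FinComplex.{u}) :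
    Function.Injective ((familyInclusion k hp).app K).hom := by
  have h : Function.Injective (Finsupp.lmapDomain k k fun t : Family p K =>
      (⟨t.1, trivial⟩ : Family (fun _ _ => True) K)) :=
    Finsupp.mapDomain_injective fun _ _ h => Subtype.ext (Subtype.mk.inj h)
  rwa [← linearize_some_comp] at h

open Classical in
theorem isStable_tuple (i : ℕ) : IsStable.{u} (Q := Fin (i + 1))
    fun K t => Finset.univ.image t ∈ K.toComplex.faces :=
  fun _ _ f t ht => (Tuple.map f ⟨t, ht⟩).2

open Classical in
theorem isStable_tupleFamily (i r : ℕ) : IsStable.{u} (Q := Fin r × Fin (i + 1))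
    fun K t => ∀ j, (Finset.univ.image fun q => t (j, q)) ∈ K.toComplex.faces :=
  fun _ _ f t ht j => (Tuple.map f ⟨fun q => t (j, q), ht j⟩).2

/-- The map sending an ordered simplex to the simplex it spans, or to `0`. -/
def tupleToSimplex (k : Type) [CommRing k] (i : ℕ) :
    familyModule k (isStable_tuple.{u} i) ⟶ simplexModule k i where
  app K := ModuleCat.ofHom (linearize k (Tuple.simplex (K := K)))
  naturality _ _ f := ModuleCat.hom_ext (linearize_comm fun t => Tuple.simplex_map f t)

theorem tupleToSimplex_app_surjective (k : Type) [CommRing k] (i : ℕ) (K : FinComplex.{u}) :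
    Function.Surjective ((tupleToSimplex k i).app K).hom :=
  linearize_surjective Tuple.exists_simplex_eq

/-- The map sending a family of ordered simplices to the set of the simplices they span, or
to `0`. -/
def tupleFamilyToSimplexSubset (k : Type) [CommRing k] (i r : ℕ) :
    familyModule k (isStable_tupleFamily.{u} i r) ⟶ simplexSubsetModule k i r where
  app K := ModuleCat.ofHom (linearize k fun t =>
    simplexSet fun j => (⟨fun q => t.1 (j, q), t.2 j⟩ : K.Tuple i))
  naturality K _ f := ModuleCat.hom_ext (linearize_comm fun t =>
    simplexSet_map f fun j => (⟨fun q => t.1 (j, q), t.2 j⟩ : K.Tuple i))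

theorem tupleFamilyToSimplexSubset_app_surjective (k : Type) [CommRing k] (i r : ℕ)
    (K : FinComplex.{u}) :
    Function.Surjective ((tupleFamilyToSimplexSubset k i r).app K).hom :=
  linearize_surjective fun S => by
    obtain ⟨T, hT⟩ := exists_simplexSet_eq S
    exact ⟨⟨fun x => (T x.1).1 x.2, fun j => (T j).2⟩, hT⟩

/-- The map sending an ordered simplex to the corresponding oriented simplex. -/
def tupleToChain (i : ℕ) :
    familyModule ℤ (isStable_tuple.{u} i) ⟶ chainFunctor ⋙ HomologicalComplex.eval _ _ i where
  app K := ModuleCat.ofHom (K.orientationRel i).mkQ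
  naturality {K L} f := congrArg ModuleCat.ofHom <| by
    refine Finsupp.lhom_ext' fun t => LinearMap.ext_ring ?_
    refine (congrArg (L.orientationRel i).mkQ (linearize_single ℤ _ t)).trans ?_
    exact (chainMap_chain f t).symm

theorem tupleToChain_app_surjective (i : ℕ) (K : FinComplex.{u}) :
    Function.Surjective ((tupleToChain i).app K).hom :=
  (K.orientationRel i).mkQ_surjective

end FinComplex

/-! ### Subquotients of the modules of vertex families -/

namespace FIModule

variable {k : Type} [CommRing k]

theorem isSubquotient_whiskerLeft (X : FIComplex.{u}) {F G H : FinComplex.{u} ⥤ ModuleCat.{u} k}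
    (ι : F ⟶ G) (π : F ⟶ H) (hι : ∀ K, Function.Injective (ι.app K).hom)
    (hπ : ∀ K, Function.Surjective (π.app K).hom) : IsSubquotient (X ⋙ H) (X ⋙ G) :=
  ⟨X ⋙ F, Functor.whiskerLeft X ι, Functor.whiskerLeft X π,
    @NatTrans.mono_of_mono_app _ _ _ _ _ _ _
      fun n => (ModuleCat.mono_iff_injective _).2 (hι (X.obj n)),
    @NatTrans.epi_of_epi_app _ _ _ _ _ _ _
      fun n => (ModuleCat.epi_iff_surjective _).2 (hπ (X.obj n))⟩

theorem isSubquotient_of_familyModule (X : FIComplex.{u}) {Q : Type}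
    {p : ∀ K : FinComplex.{u}, (Q → K.vertex) → Prop} {hp : FinComplex.IsStable p}
    {H : FinComplex.{u} ⥤ ModuleCat.{u} k} (π : FinComplex.familyModule k hp ⟶ H)
    (hπ : ∀ K, Function.Surjective (π.app K).hom) :
    IsSubquotient (X ⋙ H) (X ⋙ FinComplex.vertexFamilyModule k Q) :=
  isSubquotient_whiskerLeft X _ π (FinComplex.familyInclusion_app_injective k hp) hπ

/-- The intermediate module is that of the `i`-cycles, included in chains and projecting onto
homology. -/
theorem isSubquotient_homology (X : FIComplex.{u}) (i : ℕ) :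
    IsSubquotient (FIComplex.homology X i)
      (X ⋙ FinComplex.chainFunctor ⋙ HomologicalComplex.eval _ _ i) :=
  isSubquotient_whiskerLeft X
    (F := FinComplex.chainFunctor ⋙ HomologicalComplex.cyclesFunctor _ _ i)
    { app := fun K => K.chainComplex.iCycles i
      naturality := fun _ _ f =>
        HomologicalComplex.cyclesMap_i (FinComplex.chainFunctor.map f) i }
    (Functor.whiskerLeft _ (HomologicalComplex.natTransHomologyπ _ _ i))
    (fun K => (ModuleCat.mono_iff_injective _).1
      (inferInstanceAs (Mono (K.chainComplex.iCycles i))))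
    (fun K => (ModuleCat.epi_iff_surjective _).1
      (inferInstanceAs (Epi (K.chainComplex.homologyπ i))))

end FIModule

/-! ### Degree of generation of vertex families -/

namespace FIComplex

/-- The coordinate at `{v}` is a linear functional. If `v` were never hit from degree `≤ d`, it
would kill a spanning set, yet it is `1` on the basis element `{v}`. Real coefficients are left
behind here, so that `ℤ` can be used for homology. -/
theorem IsVertexStable.exists_vertex {X : FIComplex.{u}} {d : ℕ} (hX : X.IsVertexStable d)
    {n : FI} (v : (X.obj n).vertex) :
    ∃ (m : FI) (f : m ⟶ n) (w : (X.obj m).vertex), m.size ≤ d ∧ (X.map f).toFun w = v := by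
  classical
  obtain ⟨S, -, hd, hspan⟩ := hX
  by_contra! H
  let s : (X.obj n).Simplex 0 := ⟨{v}, (X.obj n).toComplex.singleton_mem v, by simp⟩
  have hle : ∀ y : (X.obj n).Simplex 0 →₀ ℝ, y s = 0 := by
    intro y
    have hy : (show (simplices X 0).obj n from y) ∈ Submodule.span ℝ {y : (simplices X 0).obj n |
      ∃ x ∈ S, ∃ f : x.1 ⟶ n, y = ((simplices X 0).map f).hom x.2}  := by
      rw [hspan n]; exact Submodule.mem_top
    let c : ((X.obj n).Simplex 0 →₀ ℝ) →ₗ[ℝ] ℝ := Finsupp.lapply s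
    let c' : (simplices X 0).obj n →ₗ[ℝ] ℝ := c
    refine Submodule.span_le (p := LinearMap.ker c').2 ?_ hy
    rintro _ ⟨x, hx, f, rfl⟩
    refine linearize_apply_eq_zero (fun t ht => ?_) _
    obtain ⟨w, hw⟩ := Finset.card_eq_one.1 t.2.2
    have := FinComplex.simplexMap_eq_some_iff.1 ht
    rw [hw, Finset.image_singleton, Finset.singleton_inj] at this
    exact H x.1 f w (hd x hx) this
  simpa using hle (Finsupp.single s 1)

theorem IsVertexStable.exists_family {X : FIComplex.{u}} {d : ℕ} (hX : X.IsVertexStable d)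
    {Q : Type} [Finite Q] {n : FI} (t : Q → (X.obj n).vertex) :
    ∃ (m : FI) (f : m ⟶ n) (t' : Q → (X.obj m).vertex),
      m.size ≤ d * Nat.card Q ∧ (X.map f).toFun ∘ t' = t := by
  classical
  have := Fintype.ofFinite Q
  choose m f w hm hw using fun q => hX.exists_vertex (t q)
  let f' : ∀ q, Fin (m q).size ↪ Fin n.size := f
  -- The union of the images of all the `f q`. Listing it in increasing order gives an injection `g`
  -- through which every `f q` factors.
  let A : Finset (Fin n.size) := Finset.univ.biUnion fun q => Finset.univ.map (f' q)
  have hA : A.card ≤ d * Nat.card Q := by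
    refine (Finset.card_biUnion_le_card_mul _ _ d fun q _ => ?_).trans_eq ?_
    · simpa using hm q
    · rw [Finset.card_univ, Nat.card_eq_fintype_card, mul_comm]
  let g : (⟨A.card⟩ : FI) ⟶ n := (A.orderEmbOfFin rfl).toEmbedding
  have hfac : ∀ q, ∃ h : m q ⟶ ⟨A.card⟩, f q = h ≫ g := by
    intro q
    have hr : ∀ a : Fin (m q).size, ∃ b : Fin A.card, A.orderEmbOfFin rfl b = f' q a := by
      intro a
      rw [← Set.mem_range, Finset.range_orderEmbOfFin]
      exact Finset.mem_biUnion.2 ⟨q, Finset.mem_univ _, by simp⟩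
    choose h hh using hr
    refine ⟨⟨h, fun a b hab => (f' q).injective ?_⟩, Function.Embedding.ext fun a => (hh a).symm⟩
    rw [← hh, ← hh, hab]
  choose h hh using hfac
  refine ⟨_, g, fun q => (X.map (h q)).toFun (w q), hA, funext fun q => ?_⟩
  rw [← hw q, hh q, X.map_comp]
  rfl

theorem IsVertexStable.finGenInDegreeLE_vertexFamilyModule {X : FIComplex.{u}} {d : ℕ}
    (hX : X.IsVertexStable d) (k : Type) [CommRing k] (Q : Type) [Finite Q] :
    FIModule.FinGenInDegreeLE (X ⋙ FinComplex.vertexFamilyModule k Q) (d * Nat.card Q) := by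
  have hfin : ∀ n, Finite (X.obj n).vertex := fun n => (X.obj n).finite
  -- The generators are all families in degrees up to `d * Nat.card Q`, finite in number because
  -- each complex is finite.
  let x : (Σ m : Fin (d * Nat.card Q + 1),
      FinComplex.Family (Q := Q) (fun _ _ => True) (X.obj ⟨m⟩)) →
    Σ m : FI, (X ⋙ FinComplex.vertexFamilyModule k Q).obj m :=
    fun y => ⟨⟨y.1⟩, Finsupp.single y.2 1⟩
  refine ⟨Set.range x, Set.finite_range x, ?_, fun n => ?_⟩
  · rintro _ ⟨y, rfl⟩
    exact Nat.lt_succ_iff.1 y.1.2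
  rw [eq_top_iff]
  rintro z -
  induction z using Finsupp.induction_linear with
  | zero => exact zero_mem _
  | add y z hy hz => exact add_mem hy hz
  | single t c =>
    obtain ⟨m, f, t', hm, ht⟩ := hX.exists_family t.1
    have hc : Finsupp.single t c = c • Finsupp.single t (1 : k) := by simp
    refine hc ▸ Submodule.smul_mem _ c (Submodule.subset_span
      ⟨_, ⟨⟨⟨m.size, Nat.lt_succ_iff.2 hm⟩, t', trivial⟩, rfl⟩, f, ?_⟩)
    refine Eq.trans ?_ (linearize_single k _ _).symm
    exact congrArg (fun a => Finsupp.single a (1 : k)) (Subtype.ext ht.symm)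

end FIComplex

end

theorem mainTheorem11 (X : FIComplex.{u}) (d : ℕ) (hX : FIComplex.IsVertexStable X d) :
    (∀ i : ℕ, (FIComplex.simplices X i).IsSmall (d * (i + 1))) ∧
    (∀ i r : ℕ, (FIComplex.simplexSubsets X i r).IsSmall (r * d * (i + 1))) ∧
    (∀ i : ℕ, (FIComplex.homology X i).IsSmall (d * (i + 1))) ∧
    FIComplex.IsRepresentationStable X := by
  have hH : ∀ i : ℕ, (FIComplex.homology X i).IsSmall (d * (i + 1)) := fun i =>
    ((FIModule.isSubquotient_homology X i).trans
      (FIModule.isSubquotient_of_familyModule X _ (FinComplex.tupleToChain_app_surjective i))).isSmall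
      (by simpa using hX.finGenInDegreeLE_vertexFamilyModule ℤ (Fin (i + 1)))
  refine ⟨fun i => ?_, fun i r => ?_, hH, fun i => (hH i).1⟩
  · exact (FIModule.isSubquotient_of_familyModule X _
      (FinComplex.tupleToSimplex_app_surjective ℝ i)).isSmall
      (by simpa using hX.finGenInDegreeLE_vertexFamilyModule ℝ (Fin (i + 1)))
  · exact (FIModule.isSubquotient_of_familyModule X _
      (FinComplex.tupleFamilyToSimplexSubset_app_surjective ℝ i r)).isSmall
      -- A choice of `r` ordered `i`-simplices is a family of `r * (i + 1)` vertices.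
      (by simpa [mul_assoc, mul_left_comm] using
        hX.finGenInDegreeLE_vertexFamilyModule ℝ (Fin r × Fin (i + 1)))
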